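/- Let $n \ge 2$, let $F$ be a field of characteristic $2$, and let $\mathfrak v : F \to \Gamma \cup \{\infty\}$ be a surjective valuation whose value group $\Gamma$ is a totally ordered abelian group isomorphic, as a group, to $\mathbb Z^n$ (for instance a discrete valuation of rank $n$, where $\Gamma \cong \mathbb Z^n$ with the lexicographic order). Notation. Write $[a,b]$ for the quadratic form $ax^2+xy+by^2$. For $\beta_1,\dots,\beta_{n-1}\in F^\times$ and $a \in F$, the quadratic $n$-fold Pfister form $\langle\langle \beta_1,\dots,\beta_{n-1},a]]$ is the orthogonal sum of the forms $\bigl(\prod_{i\in S}\beta_i\bigr)\cdot[1,a]$ over all $S\subseteq\{1,\dots,n-1\}$. An inseparable quadratic splitting field of a quadratic Pfister form $\varphi$ is an inseparable field extension $K/F$ of degree $2$ such that $\varphi_K$ is hyperbolic. Then there exist $2^n-1$ anisotropic, pairwise non-isometric quadratic $n$-fold Pfister forms over $F$ with no common inseparable quadratic splitting field, i.e. there is no inseparable quadratic extension $K/F$ that is a splitting field of all of them. More precisely, there exist $\alpha_1,\dots,\alpha_n\in F^\times$ with $\mathfrak v(\alpha_i)<0$ for all $i$ such that the classes of $\mathfrak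 v(\alpha_1),\dots,\mathfrak v(\alpha_n)$ in $\Gamma/2\Gamma$ are linearly independent over $\mathbb F_2$. For every such choice of $\alpha_1,\dots,\alpha_n$, the $2^n-1$ forms $$\varphi_{\mathbf d}=\langle\langle \alpha_1,\dots,\widehat{\alpha_\ell},\dots,\alpha_n,\ \alpha^{\mathbf d}]],\qquad \mathbf d=(d_1,\dots,d_n)\in\{0,1\}^n\setminus\{\mathbf 0\},$$ where $\alpha^{\mathbf d}=\prod_{i=1}^n\alpha_i^{d_i}$, $\ell$ is the least index with $d_\ell\neq 0$, and the hat means that $\alpha_\ell$ is omitted, are anisotropic, pairwise non-isometric quadratic $n$-fold Pfister forms with no common inseparable quadratic splitting field. -/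

import Mathlib

open scoped TensorProduct

universe u v w

namespace QuadPfister

section Forms

variable {F : Type u} [Field F]

/-- The binary quadratic form `[a, b] : (x, y) ↦ a x² + x y + b y²`. -/
noncomputable def binary (a b : F) : QuadraticForm F (F × F) :=
  a • QuadraticMap.linMulLin (LinearMap.fst F F F) (LinearMap.fst F F F)
    + QuadraticMap.linMulLin (LinearMap.fst F F F) (LinearMap.snd F F F)
    + b • QuadraticMap.linMulLin (LinearMap.snd F F F) (LinearMap.snd F F F)

theorem binary_apply (a b : F) (z : F × F) :
    binary a b z = a * (z.1 * z.1) + z.1 * z.2 + b * (z.2 * z.2) := by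
  simp [binary]

/-- The product `⟨c₁, …, c_k⟩_b ⊗ Q = c₁ Q ⊥ … ⊥ c_k Q` of a diagonal bilinear form and a
quadratic form. -/
noncomputable def diagTensor {ι : Type w} [Fintype ι] {V : Type v} [AddCommGroup V] [Module F V]
    (c : ι → F) (Q : QuadraticForm F V) : QuadraticForm F (ι → V) :=
  QuadraticMap.pi fun i => c i • Q

/-- The diagonal entries of the bilinear Pfister form
`⟨⟨β_i : i ∈ ι⟩⟩_b = ⨂_i ⟨1, β_i⟩_b`: the entry at `S ⊆ ι` is `∏ i ∈ S, β_i`. -/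
def pfisterEntries {ι : Type w} (β : ι → F) : Finset ι → F :=
  fun S => ∏ i ∈ S, β i

/-- The quadratic Pfister form `⟨⟨β_i (i ∈ ι), a]] = ⟨⟨β_i : i ∈ ι⟩⟩_b ⊗ [1, a]`, which is
`(#ι + 1)`-fold. -/
noncomputable def pfister {ι : Type w} [Fintype ι] (β : ι → F) (a : F) :
    QuadraticForm F (Finset ι → F × F) :=
  diagTensor (pfisterEntries β) (binary 1 a)

theorem pfister_apply {ι : Type w} [Fintype ι] (β : ι → F) (a : F) (x : Finset ι → F × F) :
    pfister β a x = ∑ S : Finset ι, (∏ i ∈ S, β i) *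
      ((x S).1 * (x S).1 + (x S).1 * (x S).2 + a * ((x S).2 * (x S).2)) := by
  simp [pfister, diagTensor, pfisterEntries, binary_apply]

/-- `Q` is (isometric to) a quadratic `n`-fold Pfister form `⟨⟨β₁, …, β_{n-1}, a]]` with
nonzero `β_i`; here `n ≥ 1`. -/
def IsPfister (n : ℕ) {V : Type v} [AddCommGroup V] [Module F V] (Q : QuadraticForm F V) : Prop :=
  ∃ (β : Fin (n - 1) → F) (a : F), (∀ i, β i ≠ 0) ∧ Q.Equivalent (pfister β a)

/-- `Q` is isometric to an orthogonal sum of hyperbolic planes, i.e. to the canonical form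
`(f, x) ↦ f x` on `W* × W` with `W = F^r`. -/
def IsHyperbolic {V : Type v} [AddCommGroup V] [Module F V] (Q : QuadraticForm F V) : Prop :=
  ∃ r : ℕ, Q.Equivalent (QuadraticForm.dualProd F (Fin r → F))

end Forms

section ScalarExtension

variable {F : Type u} [Field F] (K : Type w) [Field K] [Algebra F K]
variable {V : Type v} [AddCommGroup V] [Module F V]

/-- The scalar extension `Q_K` of `Q` to `K ⊗ V`. It is built from some bilinear form `B`
(not necessarily symmetric) with `Q x = B x x`, which exists in every characteristic; the lemmas
below show that `Q_K` does not depend on the choice of `B`. -/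
noncomputable def scalarExtension (Q : QuadraticForm F V) : QuadraticForm K (K ⊗[F] V) :=
  LinearMap.BilinMap.toQuadraticMap
    (LinearMap.BilinForm.baseChange K
      (Classical.choose (LinearMap.BilinMap.toQuadraticMap_surjective Q)))

theorem scalarExtension_tmul (Q : QuadraticForm F V) (a : K) (x : V) :
    scalarExtension K Q (a ⊗ₜ[F] x) = a * a * algebraMap F K (Q x) := by
  have h := Classical.choose_spec (LinearMap.BilinMap.toQuadraticMap_surjective Q)
  have hx := congrArg (fun q : QuadraticForm F V => q x) h
  simp only [LinearMap.BilinMap.toQuadraticMap_apply] at hx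
  simp only [scalarExtension, LinearMap.BilinMap.toQuadraticMap_apply,
    LinearMap.BilinForm.baseChange_tmul, hx, Algebra.smul_def]
  ring

theorem polar_scalarExtension_tmul (Q : QuadraticForm F V) (a b : K) (x y : V) :
    QuadraticMap.polar (scalarExtension K Q) (a ⊗ₜ[F] x) (b ⊗ₜ[F] y)
      = a * b * algebraMap F K (QuadraticMap.polar Q x y) := by
  have h := Classical.choose_spec (LinearMap.BilinMap.toQuadraticMap_surjective Q)
  have hx := congrArg (fun q : QuadraticForm F V => QuadraticMap.polar q x y) h
  simp only [LinearMap.BilinMap.polar_toQuadraticMap] at hx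
  rw [scalarExtension, LinearMap.BilinMap.polar_toQuadraticMap, ← hx,
    LinearMap.BilinForm.baseChange_tmul, LinearMap.BilinForm.baseChange_tmul, map_add,
    Algebra.smul_def, Algebra.smul_def]
  ring

/-- `K` is a splitting field of `Q`: the form `Q_K` is hyperbolic. -/
def Splits (Q : QuadraticForm F V) : Prop :=
  IsHyperbolic (scalarExtension K Q)

variable (F) in
/-- `K / F` is an inseparable quadratic field extension. -/
def IsInseparableQuadratic : Prop :=
  Module.finrank F K = 2 ∧ ¬ Algebra.IsSeparable F K

end ScalarExtension

/-- No inseparable quadratic extension `K` of `F` splits all the forms of the family `Q`. Every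
quadratic extension of `F` is isomorphic over `F` to one in the universe of `F`. -/
def NoCommonInseparableQuadraticSplittingField {F : Type u} [Field F] {ι : Type w}
    {V : ι → Type v} [∀ i, AddCommGroup (V i)] [∀ i, Module F (V i)]
    (Q : ∀ i, QuadraticForm F (V i)) : Prop :=
  ∀ (K : Type u) [Field K] [Algebra F K],
    IsInseparableQuadratic F K → ¬ ∀ i, Splits K (Q i)

section Valued

variable {F : Type u} [Field F] {Γ : Type v} [AddCommGroup Γ] [LinearOrder Γ]
  [IsOrderedAddMonoid Γ]

/-- The class of `v x` in `Γ / 2Γ`, for `x ≠ 0` (and `0` for `x = 0`). -/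
noncomputable def valueClass (v : AddValuation F (WithTop Γ)) (x : F) : ModN Γ 2 :=
  ModN.mkQ 2 ((v x).untopD 0)

/-- The elements `α_i` have negative values, and these are linearly independent over `𝔽₂`
modulo `2Γ`. -/
def IsNegativeIndependent {ι : Type w} (v : AddValuation F (WithTop Γ)) (α : ι → F) : Prop :=
  (∀ i, v (α i) < 0) ∧ LinearIndependent (ZMod 2) fun i => valueClass v (α i)

end Valued

section Family

variable {F : Type u} [Field F]

/-- The form `⟨⟨α₁, …, α̂_ℓ, …, α_n⟩⟩ ⊗ ⟨⟨α^d]]` attached to a nonzero `d ∈ {0, 1}ⁿ`, where `d` is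
given by its support `D`, `α^d = ∏ i ∈ D, α_i`, and `ℓ = min D`. -/
noncomputable def familyForm {n : ℕ} (α : Fin n → F) (D : {D : Finset (Fin n) // D.Nonempty}) :
    QuadraticForm F (Finset {i : Fin n // i ≠ D.1.min' D.2} → F × F) :=
  pfister (fun i => α i.1) (∏ i ∈ D.1, α i)

end Family

end QuadPfister

namespace QuadPfister

section ValueClass

variable {F : Type u} [Field F] {Γ : Type v} [AddCommGroup Γ] [LinearOrder Γ]
  [IsOrderedAddMonoid Γ] (val : AddValuation F (WithTop Γ))

theorem exists_val_eq_coe {x : F} (hx : x ≠ 0) : ∃ g : Γ, val x = g := by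
  obtain ⟨g, hg⟩ := WithTop.ne_top_iff_exists.1 ((AddValuation.ne_top_iff val).2 hx)
  exact ⟨g, hg.symm⟩

theorem valueClass_congr {x y : F} (h : val x = val y) : valueClass val x = valueClass val y := by
  simp [valueClass, h]

omit [LinearOrder Γ] [IsOrderedAddMonoid Γ] in
theorem modN_two_add_self (g : ModN Γ 2) : g + g = 0 := by
  have h : (2 : ZMod 2) • g = 0 := by
    rw [show (2 : ZMod 2) = 0 from rfl, zero_smul]
  rwa [two_smul] at h

@[simp]
theorem valueClass_one : valueClass val 1 = 0 := by
  simp [valueClass]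

theorem valueClass_mul {x y : F} (hx : x ≠ 0) (hy : y ≠ 0) :
    valueClass val (x * y) = valueClass val x + valueClass val y := by
  obtain ⟨g, hg⟩ := exists_val_eq_coe val hx
  obtain ⟨h, hh⟩ := exists_val_eq_coe val hy
  rw [valueClass, valueClass, valueClass, AddValuation.map_mul, hg, hh, ← WithTop.coe_add]
  simp

theorem valueClass_mul_self (x : F) : valueClass val (x * x) = 0 := by
  by_cases hx : x = 0
  · simp [hx, valueClass]
  · rw [valueClass_mul val hx hx, modN_two_add_self]

theorem valueClass_mul_mul_self {x y : F} (hx : x ≠ 0) (hy : y ≠ 0) :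
    valueClass val (x * (y * y)) = valueClass val x := by
  rw [valueClass_mul val hx (mul_ne_zero hy hy), valueClass_mul_self, add_zero]

theorem valueClass_prod {ι : Type w} (s : Finset ι) (f : ι → F) (hf : ∀ i ∈ s, f i ≠ 0) :
    valueClass val (∏ i ∈ s, f i) = ∑ i ∈ s, valueClass val (f i) := by
  classical
  induction s using Finset.induction_on with
  | empty => simp
  | insert i s hi ih =>
    rw [Finset.prod_insert hi, Finset.sum_insert hi, valueClass_mul val
      (hf i (Finset.mem_insert_self i s))
      (Finset.prod_ne_zero_iff.2 fun j hj => hf j (Finset.mem_insert_of_mem hj)),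
      ih fun j hj => hf j (Finset.mem_insert_of_mem hj)]

theorem val_mul_lt_mul {x x' y y' : F} (hx : x ≠ 0) (h : val x ≤ val x') (h' : val y < val y') :
    val (x * y) < val (x' * y') := by
  rw [AddValuation.map_mul, AddValuation.map_mul]
  exact WithTop.add_lt_add_of_le_of_lt ((AddValuation.ne_top_iff val).2 hx) h h'

theorem val_lt_of_mul_self_lt {x y : F} (h : val (x * x) < val (y * y)) : val x < val y := by
  by_contra! hle
  rw [AddValuation.map_mul, AddValuation.map_mul] at h
  exact absurd h (not_lt.2 (add_le_add hle hle))

theorem val_sum_eq_of_lt {ι : Type w} {s : Finset ι} {f : ι → F} {i : ι} (hi : i ∈ s)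
    (h0 : f i ≠ 0) (h : ∀ j ∈ s, j ≠ i → val (f i) < val (f j)) :
    val (∑ j ∈ s, f j) = val (f i) := by
  classical
  rw [← Finset.add_sum_erase s f hi]
  refine AddValuation.map_add_eq_of_lt_left val
    (AddValuation.map_lt_sum val ((AddValuation.ne_top_iff val).2 h0) fun j hj => ?_)
  exact h j (Finset.mem_of_mem_erase hj) (Finset.ne_of_mem_erase hj)

end ValueClass

section Coordinates

variable {F : Type u} [Field F] {ι : Type w}

/-- The diagonal coefficients of `diagTensor c (binary 1 a)`. -/
def weight (c : ι → F) (a : F) : ι ⊕ ι → F :=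
  Sum.elim c fun i => c i * a

/-- The coordinates of a vector, indexed as the coefficients in `weight`. -/
def coord (z : ι → F × F) : ι ⊕ ι → F :=
  Sum.elim (fun i => (z i).1) fun i => (z i).2

/-- The diagonal terms of `diagTensor c (binary 1 a) z`. -/
def term (c : ι → F) (a : F) (z : ι → F × F) (j : ι ⊕ ι) : F :=
  weight c a j * (coord z j * coord z j)

theorem exists_coord_ne_zero {z : ι → F × F} (hz : z ≠ 0) : ∃ j, coord z j ≠ 0 := by
  by_contra! h
  exact hz (funext fun i => Prod.ext (h (Sum.inl i)) (h (Sum.inr i)))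

variable [Fintype ι]

theorem diagTensor_binary_apply (c : ι → F) (a : F) (z : ι → F × F) :
    diagTensor c (binary 1 a) z = ∑ j, term c a z j + ∑ i, c i * ((z i).1 * (z i).2) := by
  simp only [diagTensor, QuadraticMap.pi_apply, smul_apply, binary_apply,
    Fintype.sum_sum_type, term, weight, coord, Sum.elim_inl, Sum.elim_inr, smul_eq_mul,
    ← Finset.sum_add_distrib]
  exact Finset.sum_congr rfl fun i _ => by ring

theorem polar_diagTensor_binary [CharP F 2] (c : ι → F) (a : F) (x y : ι → F × F) :
    QuadraticMap.polar (diagTensor c (binary 1 a)) x y =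
      ∑ i, c i * ((x i).1 * (y i).2) + ∑ i, c i * ((x i).2 * (y i).1) := by
  have h2 : (2 : F) = 0 := CharTwo.two_eq_zero
  simp only [QuadraticMap.polar, diagTensor, QuadraticMap.pi_apply, smul_apply,
    binary_apply, smul_eq_mul, ← Finset.sum_add_distrib, ← Finset.sum_sub_distrib, Pi.add_apply,
    Prod.fst_add, Prod.snd_add]
  refine Finset.sum_congr rfl fun i _ => ?_
  linear_combination (c i * ((x i).1 * (y i).1 + a * ((x i).2 * (y i).2))) * h2

end Coordinates

section Separated

variable {F : Type u} [Field F] {Γ : Type v} [AddCommGroup Γ] [LinearOrder Γ]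
  [IsOrderedAddMonoid Γ] {ι : Type w}

/-- The coefficients of `diagTensor c (binary 1 a)` are nonzero, have pairwise distinct values
modulo `2Γ`, and `a` has negative value. -/
structure Separated (val : AddValuation F (WithTop Γ)) (c : ι → F) (a : F) : Prop where
  ne_zero : ∀ i, c i ≠ 0
  neg : val a < 0
  injective : Function.Injective fun j => valueClass val (weight c a j)

namespace Separated

variable {val : AddValuation F (WithTop Γ)} {c : ι → F} {a : F} (h : Separated val c a)
include h

theorem a_ne_zero : a ≠ 0 := by
  rintro rfl
  simpa using h.neg

theorem weight_ne_zero (j : ι ⊕ ι) : weight c a j ≠ 0 := by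
  cases j with
  | inl i => exact h.ne_zero i
  | inr i => exact mul_ne_zero (h.ne_zero i) h.a_ne_zero

theorem term_ne_zero {z : ι → F × F} {j : ι ⊕ ι} (hj : coord z j ≠ 0) : term c a z j ≠ 0 :=
  mul_ne_zero (h.weight_ne_zero j) (mul_ne_zero hj hj)

theorem valueClass_term {z : ι → F × F} {j : ι ⊕ ι} (hj : coord z j ≠ 0) :
    valueClass val (term c a z j) = valueClass val (weight c a j) :=
  valueClass_mul_mul_self val (h.weight_ne_zero j) hj

variable [Fintype ι]

theorem exists_dominant_term {z : ι → F × F} (hz : z ≠ 0) :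
    ∃ j, coord z j ≠ 0 ∧ ∀ k, k ≠ j → val (term c a z j) < val (term c a z k) := by
  obtain ⟨j₀, hj₀⟩ := exists_coord_ne_zero hz
  obtain ⟨j, -, hj⟩ := Finset.exists_min_image Finset.univ (fun j => val (term c a z j))
    ⟨j₀, Finset.mem_univ _⟩
  have hfin : val (term c a z j) ≠ ⊤ :=
    ((hj j₀ (Finset.mem_univ _)).trans_lt
      (lt_top_iff_ne_top.2 ((AddValuation.ne_top_iff val).2 (h.term_ne_zero hj₀)))).ne
  have hne : ∀ {k}, val (term c a z k) ≠ ⊤ → coord z k ≠ 0 := by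
    intro k hk h0
    exact hk (by simp [term, h0])
  refine ⟨j, hne hfin, fun k hk => lt_of_le_of_ne (hj k (Finset.mem_univ _)) fun heq => hk ?_⟩
  apply h.injective
  change valueClass val _ = valueClass val _
  rw [← h.valueClass_term (hne (heq ▸ hfin)), ← h.valueClass_term (hne hfin)]
  exact valueClass_congr val heq.symm

theorem val_apply {z : ι → F × F} {j : ι ⊕ ι} (hj : coord z j ≠ 0)
    (hlt : ∀ k, k ≠ j → val (term c a z j) < val (term c a z k)) :
    val (diagTensor c (binary 1 a) z) = val (term c a z j) := by
  have hsum : val (∑ k, term c a z k) = val (term c a z j) :=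
    val_sum_eq_of_lt val (Finset.mem_univ j) (h.term_ne_zero hj) fun k _ => hlt k
  have hle : ∀ k, val (term c a z j) ≤ val (term c a z k) := fun k => by
    by_cases hk : k = j
    · rw [hk]
    · exact (hlt k hk).le
  rw [diagTensor_binary_apply, ← hsum]
  refine AddValuation.map_add_eq_of_lt_left val ?_
  rw [hsum]
  refine AddValuation.map_lt_sum val ((AddValuation.ne_top_iff val).2 (h.term_ne_zero hj))
    fun i _ => ?_
  by_cases hy : (z i).2 = 0
  · rw [hy, mul_zero, mul_zero, AddValuation.map_zero]
    exact lt_top_iff_ne_top.2 ((AddValuation.ne_top_iff val).2 (h.term_ne_zero hj))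
  apply val_lt_of_mul_self_lt
  have hsnd : val (term c a z j) < val (c i * ((z i).2 * (z i).2)) := by
    refine (hle (Sum.inr i)).trans_lt ?_
    have hcy : c i * ((z i).2 * (z i).2) ≠ 0 := mul_ne_zero (h.ne_zero i) (mul_ne_zero hy hy)
    have := val_mul_lt_mul val hcy le_rfl (h.neg.trans_eq (AddValuation.map_one val).symm)
    rwa [mul_one, mul_right_comm] at this
  have := val_mul_lt_mul val (h.term_ne_zero hj) (hle (Sum.inl i)) hsnd
  convert this using 2
  simp only [term, weight, coord, Sum.elim_inl]
  ring

theorem exists_dominant {z : ι → F × F} (hz : z ≠ 0) :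
    ∃ j, coord z j ≠ 0 ∧ (∀ k, k ≠ j → val (term c a z j) < val (term c a z k)) ∧
      diagTensor c (binary 1 a) z ≠ 0 ∧
      valueClass val (diagTensor c (binary 1 a) z) = valueClass val (weight c a j) := by
  obtain ⟨j, hj, hlt⟩ := h.exists_dominant_term hz
  have hv := h.val_apply hj hlt
  refine ⟨j, hj, hlt, ?_, ?_⟩
  · rw [← AddValuation.ne_top_iff val, hv]
    exact (AddValuation.ne_top_iff val).2 (h.term_ne_zero hj)
  · rw [valueClass_congr val hv, h.valueClass_term hj]

theorem anisotropic : (diagTensor c (binary 1 a)).Anisotropic := by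
  intro z hz
  by_contra h0
  obtain ⟨j, -, -, hne, -⟩ := h.exists_dominant h0
  exact hne hz

theorem polar_ne_zero_of_dominant [CharP F 2] {x y : ι → F × F} {i : ι}
    (hx : coord x (Sum.inl i) ≠ 0)
    (hxlt : ∀ k, k ≠ Sum.inl i → val (term c a x (Sum.inl i)) < val (term c a x k))
    (hy : coord y (Sum.inr i) ≠ 0)
    (hylt : ∀ k, k ≠ Sum.inr i → val (term c a y (Sum.inr i)) < val (term c a y k)) :
    QuadraticMap.polar (diagTensor c (binary 1 a)) x y ≠ 0 := by
  let f : ι ⊕ ι → F := Sum.elim (fun r => c r * ((x r).1 * (y r).2))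
    fun r => c r * ((x r).2 * (y r).1)
  have hf : ∑ r, f r = QuadraticMap.polar (diagTensor c (binary 1 a)) x y := by
    rw [polar_diagTensor_binary, Fintype.sum_sum_type]
    rfl
  have hsq : ∀ k, term c a x k * term c a y k.swap = a * (f k * f k) := by
    rintro (r | r) <;>
    · simp only [term, weight, coord, f, Sum.elim_inl, Sum.elim_inr, Sum.swap_inl, Sum.swap_inr]
      ring
  have hf0 : f (Sum.inl i) ≠ 0 := mul_ne_zero (h.ne_zero i) (mul_ne_zero hx hy)
  rw [← hf, ← AddValuation.ne_top_iff val, val_sum_eq_of_lt val (Finset.mem_univ (Sum.inl i)) hf0]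
  · exact (AddValuation.ne_top_iff val).2 hf0
  · intro k _ hk
    apply val_lt_of_mul_self_lt
    have := val_mul_lt_mul val (h.term_ne_zero hx) (hxlt k hk).le
      (hylt k.swap fun hs => hk (by rw [← Sum.swap_swap k, hs]; rfl))
    rw [hsq, show Sum.inr i = Sum.swap (Sum.inl i) from rfl, hsq, AddValuation.map_mul,
      AddValuation.map_mul val a] at this
    exact lt_of_add_lt_add_left this

/-- Orthogonal nonzero vectors do not have values differing by the class of `a`. -/
theorem polar_ne_zero [CharP F 2] {x y : ι → F × F} (hx : x ≠ 0) (hy : y ≠ 0)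
    (hxy : valueClass val (diagTensor c (binary 1 a) x) =
      valueClass val a + valueClass val (diagTensor c (binary 1 a) y)) :
    QuadraticMap.polar (diagTensor c (binary 1 a)) x y ≠ 0 := by
  have hinr : ∀ i, valueClass val (weight c a (Sum.inr i)) =
      valueClass val a + valueClass val (weight c a (Sum.inl i)) := fun i => by
    rw [add_comm]
    exact valueClass_mul val (h.ne_zero i) h.a_ne_zero
  obtain ⟨j, hj, hjlt, -, hjc⟩ := h.exists_dominant hx
  obtain ⟨k, hk, hklt, -, hkc⟩ := h.exists_dominant hy
  rw [hjc, hkc] at hxy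
  have hyx : valueClass val (weight c a k) = valueClass val a + valueClass val (weight c a j) := by
    rw [hxy, ← add_assoc, modN_two_add_self, zero_add]
  cases j with
  | inl i =>
    obtain rfl : k = Sum.inr i := h.injective (hyx.trans (hinr i).symm)
    exact h.polar_ne_zero_of_dominant hj hjlt hk hklt
  | inr i =>
    obtain rfl : k = Sum.inl i := by
      apply h.injective
      change valueClass val _ = valueClass val _
      rw [hyx, hinr, ← add_assoc, modN_two_add_self, zero_add]
    rw [QuadraticMap.polar_comm]
    exact h.polar_ne_zero_of_dominant hk hklt hj hjlt

/-- If a square root of a nonsquare `e` splits off isotropically, some `s² e + t²` has a value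
outside `2Γ`. -/
theorem exists_valueClass_ne_zero [CharP F 2] {e : F} (he : ∀ t : F, e ≠ t * t) {x y : ι → F × F}
    (hxy : x ≠ 0 ∨ y ≠ 0)
    (heq : diagTensor c (binary 1 a) x = e * diagTensor c (binary 1 a) y)
    (hpol : QuadraticMap.polar (diagTensor c (binary 1 a)) x y = 0) :
    ∃ s t : F, s ≠ 0 ∧ valueClass val (s * s * e + t * t) ≠ 0 := by
  have hani := h.anisotropic
  have hy : y ≠ 0 := by
    rintro rfl
    rw [QuadraticMap.map_zero, mul_zero] at heq
    exact hxy.elim (fun hx => hx (hani x heq)) fun hy => hy rfl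
  obtain ⟨j, hj, -, hne, hjc⟩ := h.exists_dominant hy
  set s := coord y j
  set t := -coord x j
  set z := s • x + t • y with hz
  have hQz : diagTensor c (binary 1 a) z =
      (s * s * e + t * t) * diagTensor c (binary 1 a) y := by
    rw [hz, QuadraticMap.map_add (diagTensor c (binary 1 a)), QuadraticMap.polar_smul_left, QuadraticMap.polar_smul_right,
      hpol, QuadraticMap.map_smul, QuadraticMap.map_smul, heq]
    simp only [smul_eq_mul]
    ring
  have hst : s * s * e + t * t ≠ 0 := by
    intro h0
    refine he (t / s) ?_
    have hs : s ≠ 0 := hj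
    field_simp
    linear_combination h0 - t * t * CharTwo.two_eq_zero (R := F)
  have hzj : coord z j = 0 := by
    have : coord z j = s * coord x j + t * coord y j := by cases j <;> rfl
    rw [this]; ring
  have hz0 : z ≠ 0 := by
    intro h0
    rw [h0, QuadraticMap.map_zero] at hQz
    exact mul_ne_zero hst hne hQz.symm
  obtain ⟨k, hk, -, -, hkc⟩ := h.exists_dominant hz0
  refine ⟨s, t, hj, fun h0 => hk ?_⟩
  rw [hQz, valueClass_mul val hst hne, h0, zero_add, hjc] at hkc
  rw [← h.injective hkc, hzj]

end Separated

end Separated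

section Inseparable

variable {F : Type u} [Field F] {K : Type w} [Field K] [Algebra F K]

theorem IsInseparableQuadratic.exists_sqrt [CharP F 2] (h : IsInseparableQuadratic F K) :
    ∃ (r : K) (e : F), r * r = algebraMap F K e ∧ ∀ t, algebraMap F K t ≠ r := by
  obtain ⟨hfin, hsep⟩ := h
  have : FiniteDimensional F K := Module.finite_of_finrank_pos (by omega)
  rw [Algebra.isSeparable_def] at hsep
  push Not at hsep
  obtain ⟨r, hr⟩ := hsep
  have hint : IsIntegral F r := IsIntegral.of_finite F r
  have hder : Polynomial.derivative (minpoly F r) = 0 := by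
    by_contra h0
    exact hr ((Polynomial.separable_iff_derivative_ne_zero (minpoly.irreducible hint)).2 h0)
  have hc1 : (minpoly F r).coeff 1 = 0 := by
    have := congrArg (fun p => p.coeff 0) hder
    simpa [Polynomial.coeff_derivative] using this
  have hdvd : (minpoly F r).natDegree ∣ 2 := hfin ▸ minpoly.degree_dvd hint
  have hmon := minpoly.monic hint
  rcases (Nat.dvd_prime Nat.prime_two).1 hdvd with h1 | h2
  · rw [Polynomial.Monic, Polynomial.leadingCoeff, h1, hc1] at hmon
    exact absurd hmon zero_ne_one
  · have hlead : (minpoly F r).coeff 2 = 1 := by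
      rw [← h2]; exact hmon
    have hr0 := minpoly.aeval F r
    rw [Polynomial.aeval_eq_sum_range, h2] at hr0
    simp only [Finset.sum_range_succ, Finset.sum_range_zero, hc1, hlead] at hr0
    refine ⟨r, -(minpoly F r).coeff 0, ?_, ?_⟩
    · rw [map_neg, Algebra.algebraMap_eq_smul_one]
      linear_combination (by simpa using hr0 :
        (minpoly F r).coeff 0 • (1 : K) + r ^ 2 = 0)
    · rintro t rfl
      exact hr (isSeparable_algebraMap t)

theorem exists_eq_add_mul_of_finrank_eq_two (hfin : Module.finrank F K = 2) {r : K}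
    (hr : ∀ t, algebraMap F K t ≠ r) (a : K) : ∃ s t : F, a = s • 1 + t • r := by
  have : FiniteDimensional F K := Module.finite_of_finrank_pos (by omega)
  have hli : LinearIndependent F ![(1 : K), r] := by
    rw [LinearIndependent.pair_iff' one_ne_zero]
    intro t ht
    exact hr t (by rw [Algebra.algebraMap_eq_smul_one, ht])
  have hspan := hli.span_eq_top_of_card_eq_finrank' (by simp [hfin])
  have ha : a ∈ Submodule.span F (Set.range ![(1 : K), r]) := hspan ▸ Submodule.mem_top
  rw [Matrix.range_cons, Matrix.range_cons, Matrix.range_empty, Set.union_empty,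
    Set.singleton_union, Submodule.mem_span_pair] at ha
  obtain ⟨s, t, hst⟩ := ha
  exact ⟨s, t, hst.symm⟩

variable {V : Type v} [AddCommGroup V] [Module F V]

theorem exists_eq_tmul_add_tmul_of_finrank_eq_two (hfin : Module.finrank F K = 2) {r : K}
    (hr : ∀ t, algebraMap F K t ≠ r) (z : K ⊗[F] V) :
    ∃ x y : V, z = (1 : K) ⊗ₜ[F] x + r ⊗ₜ[F] y := by
  induction z using TensorProduct.induction_on with
  | zero => exact ⟨0, 0, by simp⟩
  | tmul a x =>
    obtain ⟨s, t, rfl⟩ := exists_eq_add_mul_of_finrank_eq_two hfin hr a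
    exact ⟨s • x, t • x, by
      rw [TensorProduct.add_tmul, TensorProduct.smul_tmul, TensorProduct.smul_tmul]⟩
  | add z z' hz hz' =>
    obtain ⟨x, y, rfl⟩ := hz
    obtain ⟨x', y', rfl⟩ := hz'
    exact ⟨x + x', y + y', by rw [TensorProduct.tmul_add, TensorProduct.tmul_add]; abel⟩

theorem IsHyperbolic.exists_isotropic [Nontrivial V] {Q : QuadraticForm F V}
    (h : IsHyperbolic Q) : ∃ z, z ≠ 0 ∧ Q z = 0 := by
  obtain ⟨r, ⟨e⟩⟩ := h
  obtain ⟨z, hz⟩ := exists_ne (0 : V)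
  have key : ∀ p : Module.Dual F (Fin r → F) × (Fin r → F), p ≠ 0 →
      QuadraticForm.dualProd F (Fin r → F) p = 0 → ∃ z, z ≠ 0 ∧ Q z = 0 := fun p hp hp0 =>
    ⟨e.symm p, fun h0 => hp (by simpa using congrArg e h0), by rw [e.symm.map_app, hp0]⟩
  by_cases h1 : (e z).1 = 0
  · exact key (e z) (fun h0 => hz (e.toLinearEquiv.map_eq_zero_iff.1 h0)) 
      (by rw [QuadraticForm.dualProd_apply, h1, LinearMap.zero_apply])
  · exact key ((e z).1, 0) (fun h0 => h1 (congrArg Prod.fst h0)) (by simp)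

/-- A form that splits over `F(√e)` takes the values `e • Q y` and `Q y` at two orthogonal
vectors. -/
theorem Splits.exists_orthogonal [CharP F 2] [Nontrivial V] {Q : QuadraticForm F V}
    (hs : Splits K Q) (hfin : Module.finrank F K = 2) {r : K} {e : F}
    (hr : ∀ t, algebraMap F K t ≠ r) (he : r * r = algebraMap F K e) :
    ∃ x y, (x ≠ 0 ∨ y ≠ 0) ∧ Q x = e * Q y ∧ QuadraticMap.polar Q x y = 0 := by
  have : Nontrivial (K ⊗[F] V) := inferInstance
  obtain ⟨z, hz, hQz⟩ := IsHyperbolic.exists_isotropic hs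
  obtain ⟨x, y, rfl⟩ := exists_eq_tmul_add_tmul_of_finrank_eq_two hfin hr z
  have hpair : ∀ s t : F, algebraMap F K s + algebraMap F K t * r = 0 → s = 0 ∧ t = 0 := by
    intro s t h0
    have ht : t = 0 := by
      by_contra ht
      have ht' : algebraMap F K t ≠ 0 := (map_ne_zero _).2 ht
      refine hr (-(s / t)) ?_
      rw [map_neg, map_div₀]
      field_simp
      linear_combination -h0
    rw [ht, map_zero, zero_mul, add_zero, map_eq_zero] at h0
    exact ⟨h0, ht⟩
  rw [QuadraticMap.map_add (scalarExtension K Q), scalarExtension_tmul, scalarExtension_tmul,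
    polar_scalarExtension_tmul, he] at hQz
  obtain ⟨h1, h2⟩ := hpair (Q x + e * Q y) (QuadraticMap.polar Q x y) (by
    rw [map_add, map_mul]
    linear_combination hQz)
  refine ⟨x, y, ?_, ?_, h2⟩
  · by_contra! h0
    exact hz (by simp [h0.1, h0.2])
  · linear_combination h1 - e * Q y * CharTwo.two_eq_zero (R := F)

theorem Splits.exists_orthogonal_of_equivalent [CharP F 2] {V' : Type*} [AddCommGroup V']
    [Module F V'] [Nontrivial V'] {Q : QuadraticForm F V} {Q' : QuadraticForm F V'}
    (hs : Splits K Q) (hQ : Q.Equivalent Q') (hfin : Module.finrank F K = 2) {r : K} {e : F}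
    (hr : ∀ t, algebraMap F K t ≠ r) (he : r * r = algebraMap F K e) :
    ∃ x y, (x ≠ 0 ∨ y ≠ 0) ∧ Q' x = e * Q' y ∧ QuadraticMap.polar Q' x y = 0 := by
  obtain ⟨f⟩ := hQ
  have : Nontrivial V := f.toLinearEquiv.toEquiv.nontrivial
  obtain ⟨x, y, hxy, heq, hpol⟩ := hs.exists_orthogonal hfin hr he
  refine ⟨f x, f y, ?_, ?_, ?_⟩
  · exact hxy.imp f.toLinearEquiv.map_ne_zero_iff.2 f.toLinearEquiv.map_ne_zero_iff.2
  · rwa [f.map_app, f.map_app]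
  · have hadd : f (x + y) = f x + f y := f.toLinearEquiv.map_add x y
    rw [QuadraticMap.polar, ← hadd, f.map_app, f.map_app, f.map_app]
    exact hpol

end Inseparable

section Reindex

variable {F : Type u} [Field F]

theorem pfister_reindex {ι : Type v} {κ : Type w} [Fintype ι] [Fintype κ] (f : ι ≃ κ)
    (β : κ → F) (a : F) : (pfister (β ∘ f) a).Equivalent (pfister β a) := by
  refine ⟨⟨LinearEquiv.funCongrLeft F (F × F) f.finsetCongr.symm, fun x => ?_⟩⟩
  rw [pfister_apply, pfister_apply, ← Equiv.sum_comp f.finsetCongr]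
  refine Finset.sum_congr rfl fun S _ => ?_
  have hx : LinearEquiv.funCongrLeft F (F × F) f.finsetCongr.symm x
      (S.map f.toEmbedding) = x S :=
    congrArg x (f.finsetCongr.symm_apply_apply S)
  simp only [AddHom.toFun_eq_coe, LinearMap.coe_toAddHom, LinearEquiv.coe_coe, hx,
    Equiv.finsetCongr_apply, Finset.prod_map, Equiv.coe_toEmbedding, Function.comp_apply]

end Reindex

section Family

variable {F : Type u} [Field F] {Γ : Type v} [AddCommGroup Γ] [LinearOrder Γ]
  [IsOrderedAddMonoid Γ] {val : AddValuation F (WithTop Γ)} {n : ℕ} {α : Fin n → F}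

omit [LinearOrder Γ] [IsOrderedAddMonoid Γ] in
theorem sum_symmDiff_modN_two {ι : Type w} [DecidableEq ι] [Fintype ι] (g : ι → ModN Γ 2)
    (A B : Finset ι) : ∑ i ∈ symmDiff A B, g i = ∑ i ∈ A, g i + ∑ i ∈ B, g i := by
  rw [← Finset.univ_inter (symmDiff A B), ← Finset.univ_inter A, ← Finset.univ_inter B,
    ← Finset.sum_ite_mem, ← Finset.sum_ite_mem, ← Finset.sum_ite_mem, ← Finset.sum_add_distrib]
  refine Finset.sum_congr rfl fun i _ => ?_
  by_cases hA : i ∈ A <;> by_cases hB : i ∈ B <;>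
    simp [Finset.mem_symmDiff, hA, hB, modN_two_add_self]

namespace IsNegativeIndependent

variable (hα : IsNegativeIndependent val α)
include hα

theorem ne_zero (i : Fin n) : α i ≠ 0 := by
  intro h0
  simpa [h0] using hα.1 i

theorem sum_injective {A B : Finset (Fin n)}
    (h : ∑ i ∈ A, valueClass val (α i) = ∑ i ∈ B, valueClass val (α i)) : A = B := by
  have hli := hα.2
  rw [Fintype.linearIndependent_iffₛ] at hli
  have := hli (fun i => if i ∈ A then 1 else 0) (fun i => if i ∈ B then 1 else 0)
    (by simpa [ite_smul, Finset.sum_ite_mem] using h)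
  ext i
  have hi := this i
  by_cases hA : i ∈ A <;> by_cases hB : i ∈ B <;> simp_all

theorem val_prod_neg {D : Finset (Fin n)} (hD : D.Nonempty) : val (∏ i ∈ D, α i) < 0 := by
  induction hD using Finset.Nonempty.cons_induction with
  | singleton i => simpa using hα.1 i
  | cons i s hi hs ih =>
    rw [Finset.prod_cons, AddValuation.map_mul]
    exact add_neg_of_neg_of_nonpos (hα.1 i) ih.le

theorem valueClass_prod (D : Finset (Fin n)) :
    valueClass val (∏ i ∈ D, α i) = ∑ i ∈ D, valueClass val (α i) :=
  QuadPfister.valueClass_prod val D α fun i _ => hα.ne_zero i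

theorem exists_sum_eq (hΓ : Nonempty (Γ ≃+ (Fin n → ℤ))) (g : ModN Γ 2) :
    ∃ D : Finset (Fin n), g = ∑ i ∈ D, valueClass val (α i) := by
  obtain ⟨f⟩ := hΓ
  have hrank : Module.finrank (ZMod 2) (ModN Γ 2) = n := by
    rw [Module.finrank_eq_card_basis
      (ModN.basis ((Pi.basisFun ℤ (Fin n)).map f.symm.toIntLinearEquiv)), Fintype.card_fin]
  have hfin : Module.Finite (ZMod 2) (ModN Γ 2) :=
    .of_basis (ModN.basis ((Pi.basisFun ℤ (Fin n)).map f.symm.toIntLinearEquiv))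
  have hspan := hα.2.span_eq_top_of_card_eq_finrank' (by rw [hrank, Fintype.card_fin])
  have hg : g ∈ Submodule.span (ZMod 2) (Set.range fun i => valueClass val (α i)) :=
    hspan ▸ Submodule.mem_top
  obtain ⟨k, hk⟩ := (Submodule.mem_span_range_iff_exists_fun (ZMod 2)).1 hg
  refine ⟨Finset.univ.filter fun i => k i = 1, ?_⟩
  rw [← hk, Finset.sum_filter]
  refine Finset.sum_congr rfl fun i _ => ?_
  rcases (by decide : ∀ t : ZMod 2, t = 0 ∨ t = 1) (k i) with h | h <;> simp [h]

end IsNegativeIndependent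

/-- The subset of `Fin n` that describes the value class of a coefficient of `familyForm α D`. -/
def weightSupport (D : {D : Finset (Fin n) // D.Nonempty}) :
    Finset {i : Fin n // i ≠ D.1.min' D.2} ⊕ Finset {i : Fin n // i ≠ D.1.min' D.2} →
      Finset (Fin n) :=
  Sum.elim (fun S => S.map (Function.Embedding.subtype _))
    fun S => symmDiff (S.map (Function.Embedding.subtype _)) D.1

theorem weightSupport_bijective (D : {D : Finset (Fin n) // D.Nonempty}) :
    Function.Bijective (weightSupport D) := by
  have hmem : D.1.min' D.2 ∈ D.1 := D.1.min'_mem D.2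
  have hnot : ∀ S : Finset {i : Fin n // i ≠ D.1.min' D.2},
      D.1.min' D.2 ∉ S.map (Function.Embedding.subtype _) := fun S => by simp
  constructor
  · rintro (S | S) (T | T) h <;> simp only [weightSupport, Sum.elim_inl, Sum.elim_inr] at h
    · rw [Finset.map_injective _ h]
    · refine absurd (h ▸ ?_) (hnot S)
      exact Finset.mem_symmDiff.2 (Or.inr ⟨hmem, hnot T⟩)
    · refine absurd (h ▸ ?_) (hnot T)
      exact Finset.mem_symmDiff.2 (Or.inr ⟨hmem, hnot S⟩)
    · rw [Finset.map_injective _ (symmDiff_left_injective _ h)]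
  · have hlift : ∀ A : Finset (Fin n), D.1.min' D.2 ∉ A →
        ∃ S : Finset {i : Fin n // i ≠ D.1.min' D.2},
          S.map (Function.Embedding.subtype _) = A := fun A hA =>
      ⟨A.subtype _, Finset.subtype_map_of_mem fun i hi h0 => hA (h0 ▸ hi)⟩
    intro A
    by_cases hA : D.1.min' D.2 ∈ A
    · obtain ⟨S, hS⟩ := hlift (symmDiff A D.1) (by simp [Finset.mem_symmDiff, hA, hmem])
      exact ⟨Sum.inr S, by simp [weightSupport, hS]⟩
    · obtain ⟨S, hS⟩ := hlift A hA
      exact ⟨Sum.inl S, by simp [weightSupport, hS]⟩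

namespace IsNegativeIndependent

variable (hα : IsNegativeIndependent val α)
include hα

theorem valueClass_pfisterEntries (D : {D : Finset (Fin n) // D.Nonempty})
    (S : Finset {i : Fin n // i ≠ D.1.min' D.2}) :
    valueClass val (pfisterEntries (fun i : {i : Fin n // i ≠ D.1.min' D.2} => α i.1) S) =
      ∑ i ∈ S.map (Function.Embedding.subtype _), valueClass val (α i) := by
  rw [pfisterEntries, QuadPfister.valueClass_prod val S _ fun i _ => hα.ne_zero i.1,
    Finset.sum_map]
  rfl

theorem valueClass_weight (D : {D : Finset (Fin n) // D.Nonempty})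
    (j : Finset {i : Fin n // i ≠ D.1.min' D.2} ⊕ Finset {i : Fin n // i ≠ D.1.min' D.2}) :
    valueClass val (weight (pfisterEntries fun i : {i : Fin n // i ≠ D.1.min' D.2} => α i.1)
      (∏ i ∈ D.1, α i) j) = ∑ i ∈ weightSupport D j, valueClass val (α i) := by
  cases j with
  | inl S => exact hα.valueClass_pfisterEntries D S
  | inr S =>
    have hS : pfisterEntries (fun i : {i : Fin n // i ≠ D.1.min' D.2} => α i.1) S ≠ 0 :=
      Finset.prod_ne_zero_iff.2 fun i _ => hα.ne_zero i.1
    rw [weight, Sum.elim_inr, valueClass_mul val hS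
      (Finset.prod_ne_zero_iff.2 fun i _ => hα.ne_zero i), hα.valueClass_pfisterEntries,
      hα.valueClass_prod, weightSupport, Sum.elim_inr, sum_symmDiff_modN_two]

theorem separated (D : {D : Finset (Fin n) // D.Nonempty}) :
    Separated val (pfisterEntries fun i : {i : Fin n // i ≠ D.1.min' D.2} => α i.1)
      (∏ i ∈ D.1, α i) where
  ne_zero _ := Finset.prod_ne_zero_iff.2 fun i _ => hα.ne_zero i.1
  neg := hα.val_prod_neg D.2
  injective j k h := by
    simp only [hα.valueClass_weight] at h
    exact (weightSupport_bijective D).1 (hα.sum_injective h)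

theorem anisotropic_familyForm (D : {D : Finset (Fin n) // D.Nonempty}) :
    (familyForm α D).Anisotropic :=
  (hα.separated D).anisotropic

theorem polar_familyForm_ne_zero [CharP F 2] (D : {D : Finset (Fin n) // D.Nonempty})
    {x y} (hx : x ≠ 0) (hy : y ≠ 0) (hxy : valueClass val (familyForm α D x) =
      ∑ i ∈ D.1, valueClass val (α i) + valueClass val (familyForm α D y)) :
    QuadraticMap.polar (familyForm α D) x y ≠ 0 :=
  (hα.separated D).polar_ne_zero hx hy (by rw [hα.valueClass_prod]; exact hxy)

theorem exists_orthogonal_familyForm [CharP F 2] {D E : {D : Finset (Fin n) // D.Nonempty}}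
    (hDE : D ≠ E) : ∃ x y, x ≠ 0 ∧ y ≠ 0 ∧
      valueClass val (familyForm α E x) =
        ∑ i ∈ D.1, valueClass val (α i) + valueClass val (familyForm α E y) ∧
      QuadraticMap.polar (familyForm α E) x y = 0 := by
  classical
  let y : Finset {i : Fin n // i ≠ E.1.min' E.2} → F × F := Pi.single ∅ (1, 0)
  have hy : y ≠ 0 := by
    simp [y, Pi.single_eq_zero_iff]
  have hQy : familyForm α E y = 1 := by
    rw [familyForm, pfister_apply, Finset.sum_eq_single ∅]
    · simp [y]
    · intro S _ hS
      simp [y, hS]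
    · simp
  have key : ∀ x, x ≠ 0 → valueClass val (familyForm α E x) = ∑ i ∈ D.1, valueClass val (α i) →
      (x ∅).2 = 0 → ∃ x y, x ≠ 0 ∧ y ≠ 0 ∧ valueClass val (familyForm α E x) =
        ∑ i ∈ D.1, valueClass val (α i) + valueClass val (familyForm α E y) ∧
      QuadraticMap.polar (familyForm α E) x y = 0 := by
    intro x hx hQx hx0
    refine ⟨x, y, hx, hy, by rw [hQx, hQy, valueClass_one, add_zero], ?_⟩
    rw [familyForm, pfister, polar_diagTensor_binary, ← Finset.sum_add_distrib]
    refine Finset.sum_eq_zero fun S _ => ?_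
    by_cases hS : S = ∅
    · subst hS
      simp [y, hx0]
    · simp [y, hS]
  obtain ⟨j, hj⟩ := (weightSupport_bijective E).2 D.1
  have hw := hα.valueClass_weight E j
  rw [hj] at hw
  cases j with
  | inl S =>
    refine key (Pi.single S (1, 0)) (by simp [Pi.single_eq_zero_iff]) ?_ ?_
    · rw [← hw]
      congr 1
      rw [familyForm, pfister_apply, Finset.sum_eq_single S]
      · simp [weight, pfisterEntries]
      · intro T _ hT
        simp [hT]
      · simp
    · by_cases hS : S = ∅
      · subst hS
        simp
      · simp [Ne.symm hS]
  | inr S =>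
    refine key (Pi.single S (0, 1)) (by simp [Pi.single_eq_zero_iff]) ?_ ?_
    · rw [← hw]
      congr 1
      rw [familyForm, pfister_apply, Finset.sum_eq_single S]
      · simp [weight, pfisterEntries]
      · intro T _ hT
        simp [hT]
      · simp
    · have hS : S ≠ ∅ := by
        rintro rfl
        refine hDE (Subtype.ext ?_)
        rw [← hj]
        simp [weightSupport]
      simp [hS.symm]

theorem not_equivalent_familyForm [CharP F 2] {D E : {D : Finset (Fin n) // D.Nonempty}}
    (hDE : D ≠ E) : ¬ (familyForm α D).Equivalent (familyForm α E) := by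
  rintro ⟨f⟩
  obtain ⟨x, y, hx, hy, hxy, hpol⟩ := hα.exists_orthogonal_familyForm hDE
  refine hα.polar_familyForm_ne_zero D (x := f.symm x) (y := f.symm y) ?_ ?_ ?_ ?_
  · exact f.symm.toLinearEquiv.map_ne_zero_iff.2 hx
  · exact f.symm.toLinearEquiv.map_ne_zero_iff.2 hy
  · rwa [f.symm.map_app, f.symm.map_app]
  · have hadd : f.symm (x + y) = f.symm x + f.symm y := f.symm.toLinearEquiv.map_add x y
    rw [QuadraticMap.polar, ← hadd, f.symm.map_app, f.symm.map_app, f.symm.map_app]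
    exact hpol

theorem noCommonInseparableQuadraticSplittingField [CharP F 2] (hn : 0 < n)
    (hΓ : Nonempty (Γ ≃+ (Fin n → ℤ))) {κ : Type w} {V : κ → Type*}
    [∀ i, AddCommGroup (V i)] [∀ i, Module F (V i)] (Q : ∀ i, QuadraticForm F (V i))
    {f : κ → {D : Finset (Fin n) // D.Nonempty}} (hf : Function.Surjective f)
    (hQ : ∀ i, (Q i).Equivalent (familyForm α (f i))) :
    NoCommonInseparableQuadraticSplittingField Q := by
  intro K _ _ hK hs
  obtain ⟨r, e, he, hr⟩ := hK.exists_sqrt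
  have he' : ∀ t : F, e ≠ t * t := by
    rintro t rfl
    rw [map_mul] at he
    have h0 : (r - algebraMap F K t) * (r + algebraMap F K t) = 0 := by
      linear_combination he
    rcases mul_eq_zero.1 h0 with h0 | h0
    · exact hr t (sub_eq_zero.1 h0).symm
    · exact hr (-t) (by rw [map_neg]; linear_combination -h0)
  obtain ⟨i, -⟩ := hf ⟨Finset.univ, ⟨⟨0, hn⟩, Finset.mem_univ _⟩⟩
  obtain ⟨x, y, hxy, heq, hpol⟩ := (hs i).exists_orthogonal_of_equivalent (hQ i) hK.1 hr he
  obtain ⟨s, t, hs0, hst⟩ :=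
    (hα.separated (f i)).exists_valueClass_ne_zero he' hxy heq hpol
  obtain ⟨D, hD⟩ := hα.exists_sum_eq hΓ (valueClass val (s * s * e + t * t))
  have hDne : D.Nonempty := by
    rw [Finset.nonempty_iff_ne_empty]
    rintro rfl
    exact hst (by rw [hD, Finset.sum_empty])
  have hne : s * s * e + t * t ≠ 0 := fun h0 => hst (by simp [h0, valueClass])
  obtain ⟨k, hk⟩ := hf ⟨D, hDne⟩
  have hs0' : algebraMap F K s ≠ 0 := (map_ne_zero _).2 hs0
  have h2 : (2 : K) = 0 := by
    rw [← map_ofNat (algebraMap F K) 2, CharTwo.two_eq_zero, map_zero]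
  obtain ⟨x', y', hxy', heq', hpol'⟩ := (hs k).exists_orthogonal_of_equivalent (hQ k) hK.1
    (r := algebraMap F K s * r + algebraMap F K t) (e := s * s * e + t * t)
    (fun b hb => hr ((b - t) / s) (by
      rw [map_div₀, map_sub, hb]
      field_simp
      ring))
    (by
      rw [map_add, map_mul, map_mul, map_mul, ← he]
      linear_combination algebraMap F K s * r * algebraMap F K t * h2)
  have hani := hα.anisotropic_familyForm (f k)
  have hy' : y' ≠ 0 := by
    rintro rfl
    rw [QuadraticMap.map_zero, mul_zero] at heq'
    exact hxy'.elim (fun hx => hx (hani _ heq')) fun hy => hy rfl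
  have hQy' : familyForm α (f k) y' ≠ 0 := fun h0 => hy' (hani _ h0)
  have hx' : x' ≠ 0 := by
    rintro rfl
    rw [QuadraticMap.map_zero] at heq'
    exact mul_ne_zero hne hQy' heq'.symm
  refine hα.polar_familyForm_ne_zero (f k) hx' hy' ?_ hpol'
  rw [heq', valueClass_mul val hne hQy', hD]
  exact congrArg (fun A => ∑ i ∈ A, valueClass val (α i) + _) (congrArg Subtype.val hk).symm

end IsNegativeIndependent

theorem exists_isNegativeIndependent (hval : Function.Surjective val)
    (hΓ : Nonempty (Γ ≃+ (Fin n → ℤ))) : ∃ α : Fin n → F, IsNegativeIndependent val α := by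
  obtain ⟨f⟩ := hΓ
  let b : Module.Basis (Fin n) ℤ Γ := (Pi.basisFun ℤ (Fin n)).map f.symm.toIntLinearEquiv
  choose α hα using fun i => hval ((-|b i| : Γ) : WithTop Γ)
  have hneg : ∀ g : ModN Γ 2, -g = g := fun g => neg_eq_of_add_eq_zero_left (modN_two_add_self g)
  have hcls : (fun i => valueClass val (α i)) = ModN.basis (n := 2) b := by
    funext i
    rw [ModN.basis_apply_eq_mkQ, valueClass, hα, WithTop.untopD_coe, map_neg, hneg]
    rcases abs_choice (b i) with h | h
    · rw [h]
    · rw [h, map_neg, hneg]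
  refine ⟨α, fun i => ?_, ?_⟩
  · rw [hα, ← WithTop.coe_zero, WithTop.coe_lt_coe, neg_lt_zero, abs_pos]
    exact b.ne_zero i
  · rw [hcls]
    exact (ModN.basis b).linearIndependent

theorem exists_pfister_equivalent_familyForm (α : Fin n → F)
    (D : {D : Finset (Fin n) // D.Nonempty}) :
    ∃ g : Fin (n - 1) → Fin n,
      (pfister (α ∘ g) (∏ i ∈ D.1, α i)).Equivalent (familyForm α D) := by
  have hcard : Fintype.card (Fin (n - 1)) = Fintype.card {i : Fin n // i ≠ D.1.min' D.2} := by
    rw [Fintype.card_subtype_compl, Fintype.card_fin, Fintype.card_fin, Fintype.card_unique]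
  exact ⟨fun i => (Fintype.equivOfCardEq hcard i).1,
    pfister_reindex (Fintype.equivOfCardEq hcard) (fun i => α i.1) _⟩

end Family

end QuadPfister

theorem theorem4p5 (n : ℕ) (hn : 2 ≤ n) {F : Type u} [Field F] [CharP F 2]
    {Γ : Type v} [AddCommGroup Γ] [LinearOrder Γ] [IsOrderedAddMonoid Γ]
    (val : AddValuation F (WithTop Γ)) (hval : Function.Surjective val)
    (hΓ : Nonempty (Γ ≃+ (Fin n → ℤ))) :
    (∃ Q : Fin (2 ^ n - 1) → QuadraticForm F (Finset (Fin (n - 1)) → F × F),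
      (∀ i, QuadPfister.IsPfister n (Q i) ∧ (Q i).Anisotropic) ∧
      (∀ i j, i ≠ j → ¬ (Q i).Equivalent (Q j)) ∧
      QuadPfister.NoCommonInseparableQuadraticSplittingField Q) ∧
    (∃ α : Fin n → F, QuadPfister.IsNegativeIndependent val α) ∧
    ∀ α : Fin n → F, QuadPfister.IsNegativeIndependent val α →
      (∀ D, QuadPfister.IsPfister n (QuadPfister.familyForm α D) ∧
        (QuadPfister.familyForm α D).Anisotropic) ∧
      (∀ D E, D ≠ E →
        ¬ (QuadPfister.familyForm α D).Equivalent (QuadPfister.familyForm α E)) ∧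
      QuadPfister.NoCommonInseparableQuadraticSplittingField (QuadPfister.familyForm α) := by
  have hex := QuadPfister.exists_isNegativeIndependent hval hΓ
  refine ⟨?_, hex, fun α hα => ⟨fun D => ⟨?_, hα.anisotropic_familyForm D⟩,
    fun D E hDE => hα.not_equivalent_familyForm hDE,
    hα.noCommonInseparableQuadraticSplittingField (by omega) hΓ _ Function.surjective_id
      fun D => QuadraticMap.Equivalent.refl _⟩⟩
  · obtain ⟨α, hα⟩ := hex
    choose g hg using QuadPfister.exists_pfister_equivalent_familyForm α
    have hcard : Fintype.card (Fin (2 ^ n - 1)) =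
        Fintype.card {D : Finset (Fin n) // D.Nonempty} := by
      simp only [Finset.nonempty_iff_ne_empty]
      rw [Fintype.card_subtype_compl, Fintype.card_finset, Fintype.card_fin, Fintype.card_fin,
        Fintype.card_unique]
    let f := Fintype.equivOfCardEq hcard
    refine ⟨fun i => QuadPfister.pfister (α ∘ g (f i)) (∏ j ∈ (f i).1, α j), fun i => ⟨?_, ?_⟩,
      fun i j hij h => ?_, ?_⟩
    · exact ⟨_, _, fun j => hα.ne_zero _, QuadraticMap.Equivalent.refl _⟩
    · obtain ⟨e⟩ := hg (f i)
      intro z hz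
      rw [← e.map_app] at hz
      exact e.toLinearEquiv.map_eq_zero_iff.1 (hα.anisotropic_familyForm (f i) _ hz)
    · exact hα.not_equivalent_familyForm (f.injective.ne hij)
        (((hg (f i)).symm.trans h).trans (hg (f j)))
    · exact hα.noCommonInseparableQuadraticSplittingField (by omega) hΓ _ f.surjective
        fun i => hg (f i)
  · obtain ⟨g, hg⟩ := QuadPfister.exists_pfister_equivalent_familyForm α D
    exact ⟨α ∘ g, _, fun i => hα.ne_zero _, hg.symm⟩
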